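/- Let $0\le k\le n$, let $G_k(n)$ be the Grassmann manifold of oriented linear $k$-planes in $\mathbb R^n$, and consider a skew fibration of $\mathbb R^n$ by oriented affine $k$-planes: $\mathbb R^n$ is partitioned into oriented affine $k$-planes (the fibers), the fiber through $x$ depends continuously on $x$, and no two distinct fibers contain parallel lines. Let $\pi\colon\mathbb R^n\to G_k(n)$ be the map sending $x$ to the oriented linear $k$-plane parallel to the fiber through $x$, and let $U=\pi(\mathbb R^n)$. Let $u\in U$ and let $\ell\in u$ be a unit vector. Then: (1) If $(y_m)$ is a sequence in $\mathbb R^n$ with $|y_m|\to\infty$ and $\frac{y_m}{|y_m|}\to\ell$, then $\pi(y_m)\to u$ in $G_k(n)$. (2) For every neighborhood $D$ of $u$ in $U$ there are $N\ge 1$ and $0<\delta<\frac{\pi}{2}$ (here $\pi$ is the number) such that every $y\in\mathbb R^n$ with $\langle y,\ell\rangle\ge N$ and $\angle(y,\ell)\le\delta$ satisfies $\pi(y)\in D$. -/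

import Mathlib

open Filter Topology

noncomputable section

namespace SkewFib

/-- The oriented Grassmannian `G_k(n)`: linear `k`-planes in `ℝⁿ` with an orientation. -/
@[ext]
structure OrientedGrassmannian (k n : ℕ) where
  plane : Submodule ℝ (EuclideanSpace ℝ (Fin n))
  finrank_plane : Module.finrank ℝ plane = k
  orientation : Orientation ℝ plane (Fin k)

/-- Linearly independent `k`-tuples of vectors of `ℝⁿ`, with the subspace topology of `(ℝⁿ)ᵏ`. -/
abbrev Frame (k n : ℕ) : Type :=
  {b : Fin k → EuclideanSpace ℝ (Fin n) // LinearIndependent ℝ b}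

/-- The span of a frame, oriented by that frame. -/
def Frame.toGrassmannian {k n : ℕ} (b : Frame k n) : OrientedGrassmannian k n where
  plane := Submodule.span ℝ (Set.range b.1)
  finrank_plane := by rw [finrank_span_eq_card b.2, Fintype.card_fin]
  orientation := (Module.Basis.span b.2).orientation

/-- The manifold topology of `G_k(n)`, as the quotient topology of the space of frames
(modulo changes of frame with positive determinant). -/
instance (k n : ℕ) : TopologicalSpace (OrientedGrassmannian k n) :=
  TopologicalSpace.coinduced Frame.toGrassmannian inferInstance

/-- The oriented affine Grassmannian `AG_k(n)`: an oriented affine `k`-plane `P` is the pair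
`(u, v)` of its oriented direction `u` and its point `v` nearest to the origin. -/
@[ext]
structure AffineOrientedGrassmannian (k n : ℕ) where
  direction : OrientedGrassmannian k n
  point : EuclideanSpace ℝ (Fin n)
  point_mem : point ∈ direction.planeᗮ

/-- The topology of `AG_k(n)` as a subspace of `G_k(n) × ℝⁿ`. -/
instance (k n : ℕ) : TopologicalSpace (AffineOrientedGrassmannian k n) :=
  TopologicalSpace.induced (fun P => (P.direction, P.point)) inferInstance

/-- The affine subspace `v + u` underlying the oriented affine plane `(u, v)`. -/
def AffineOrientedGrassmannian.toAffineSubspace {k n : ℕ} (P : AffineOrientedGrassmannian k n) :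
    AffineSubspace ℝ (EuclideanSpace ℝ (Fin n)) :=
  AffineSubspace.mk' P.point P.direction.plane

/-- A fibration of `ℝⁿ` by oriented affine `k`-planes, given as the continuous map which sends
each point `x` to the unique fiber through `x`. -/
structure IsFibration {k n : ℕ}
    (F : EuclideanSpace ℝ (Fin n) → AffineOrientedGrassmannian k n) : Prop where
  continuous : Continuous F
  mem_fiber : ∀ x, x ∈ (F x).toAffineSubspace
  fiber_eq : ∀ x y, y ∈ (F x).toAffineSubspace → F y = F x

/-- A fibration is skew if no two distinct fibers contain parallel lines. -/
structure IsSkewFibration {k n : ℕ}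
    (F : EuclideanSpace ℝ (Fin n) → AffineOrientedGrassmannian k n) : Prop
    extends IsFibration F where
  skew : ∀ x y, F x ≠ F y → ∀ l₁ l₂ : AffineSubspace ℝ (EuclideanSpace ℝ (Fin n)),
    Module.finrank ℝ l₁.direction = 1 → Module.finrank ℝ l₂.direction = 1 →
    l₁ ≤ (F x).toAffineSubspace → l₂ ≤ (F y).toAffineSubspace → ¬ l₁.Parallel l₂

/-- The map `π : ℝⁿ → G_k(n)` sending `x` to the oriented direction of the fiber through `x`. -/
def dirMap {k n : ℕ} (F : EuclideanSpace ℝ (Fin n) → AffineOrientedGrassmannian k n)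
    (x : EuclideanSpace ℝ (Fin n)) : OrientedGrassmannian k n :=
  (F x).direction

/-- The base space `U ⊆ G_k(n)`: the oriented `k`-planes which appear as (translated) fibers. -/
def baseSpace {k n : ℕ} (F : EuclideanSpace ℝ (Fin n) → AffineOrientedGrassmannian k n) :
    Set (OrientedGrassmannian k n) :=
  Set.range (dirMap F)

/-- The truncated cone of points `y` with `⟪y, ℓ⟫ ≥ N` and angle at most `δ` with `ℓ`
(the spherical distance of `y / |y|` and the unit vector `ℓ`). -/
def cone {n : ℕ} (ℓ : EuclideanSpace ℝ (Fin n)) (N δ : ℝ) : Set (EuclideanSpace ℝ (Fin n)) :=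
  {y | N ≤ inner ℝ y ℓ ∧ InnerProductGeometry.angle y ℓ ≤ δ}

end SkewFib

end

/-!
Let `P` be the orthogonal projection onto the plane `u`, let `Q t` be the orthogonal projection
onto the direction of the fiber through `t`, and let `v ∈ uᗮ` be the point nearest to the origin of
the fiber in direction `u`. Every `x ∈ ℝⁿ` splits as `x = t + a` with `t = x - P x ∈ uᗮ` and
`a = P x ∈ u`. A point `y` lies on the fiber through `t` as soon as `y = t + ‖y‖ • Q t a` for some
`a ∈ u`, that is, as soon as `x = t + a` is a zero of
`h x = ‖y‖⁻¹ • t + Q t a - ‖y‖⁻¹ • y`.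
When `‖y‖` is large and `y / ‖y‖` is close to `ℓ`, the map `h` is uniformly close, on a ball around
`x₀ = v + ℓ`, to `f x = Q t a - ℓ`, which vanishes at `x₀`. If `h` has a zero in a ball of small
radius around `x₀`, then `t` is close to `v`, and so the direction at `y`, which is the direction at
`t`, is close to `u`. This gives both claims at once (`IsSkewFibration.exists_dirMap_mem`).

The zero of `h` comes from a topological argument: it suffices that `f` is nowhere on the bounding
sphere a nonpositive multiple of `x - x₀` (`exists_forall_exists_zero_of_near`). This is where the
hypotheses on the fibration enter. Suppose `f x + μ • (x - x₀) = 0` with `μ ≥ 0`. If `μ > 0`, then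
the point `t + μ⁻¹ • Q t a` lies on the fiber through `v`; if `μ = 0`, then `ℓ` is a direction
common to the fibers through `t` and `v`. In both cases the fibers agree, by disjointness or by
skewness, so `t = v`, and then `a = ℓ`, so that `x = x₀` is not on the sphere.

The zero theorem is deduced from the absence of `C¹` retractions of a ball onto its sphere
(`not_exists_retraction_sphere`), which is proved by the volume argument of Milnor and Rogers: for a
retraction `f`, the integral over the ball of the Jacobian of `x + t • (f x - x)` is a polynomial in
`t` which equals the volume of the ball for small `t ≥ 0` and vanishes for `t = 1`.

Continuity of `Q` in the quotient topology of `G_k(n)` follows from the Gram matrix formula for the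
orthogonal projection onto the span of a frame (`continuous_starProjection_plane`).
-/

namespace SkewFib

/-! ### There is no `C¹` retraction of a ball onto its sphere -/

section Retraction
open MeasureTheory Metric

variable {E : Type*} [NormedAddCommGroup E] [InnerProductSpace ℝ E] [FiniteDimensional ℝ E]

theorem exists_polynomial_eval_eq_det_one_add_smul (A : E →L[ℝ] E) :
    ∃ p : Polynomial ℝ, p.degree < (Module.finrank ℝ E + 1 : ℕ) ∧
      ∀ t : ℝ, p.eval t = (1 + t • A).det := by
  let b := Module.finBasis ℝ E
  let M := LinearMap.toMatrix b b (A : E →ₗ[ℝ] E)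
  refine ⟨((Polynomial.X : Polynomial ℝ) • M.map Polynomial.C +
    (1 : Matrix _ _ ℝ).map Polynomial.C).det, ?_, fun t => ?_⟩
  · refine Polynomial.degree_le_natDegree.trans_lt (WithBot.coe_lt_coe.2 (Nat.lt_succ_of_le ?_))
    simpa using Polynomial.natDegree_det_X_add_C_le M 1
  · rw [ContinuousLinearMap.det, ← LinearMap.det_toMatrix b, ← Polynomial.coe_evalRingHom,
      RingHom.map_det]
    congr 1
    ext i j
    by_cases hij : i = j <;> simp [M, hij, LinearMap.toMatrix_apply, mul_comm t, add_comm]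

/-- Lagrange interpolation of `t ↦ det (1 + t • A)` with nodes in `[0, τ)`. The nodes `s i` and the
weights `c i` do not depend on `A`, so that the identity can be integrated when `A` varies. -/
theorem exists_forall_det_one_add_smul_eq_sum {τ : ℝ} (hτ : 0 < τ) :
    ∃ s c : ℕ → ℝ, (∀ i ∈ Finset.range (Module.finrank ℝ E + 1), 0 ≤ s i ∧ s i < τ) ∧
      ∀ A : E →L[ℝ] E, (1 + A).det =
        ∑ i ∈ Finset.range (Module.finrank ℝ E + 1), c i * (1 + s i • A).det := by
  set d := Module.finrank ℝ E + 1
  have hd : (0 : ℝ) < d := by positivity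
  let s : ℕ → ℝ := fun i => τ * (i / d)
  have hs : Set.InjOn s (Finset.range d) := by
    intro i _ j _ h
    have h' : (i : ℝ) / d = j / d := mul_left_cancel₀ hτ.ne' h
    exact_mod_cast (div_left_inj' hd.ne').1 h'
  refine ⟨s, fun i => (Lagrange.basis (Finset.range d) s i).eval 1, fun i hi => ⟨by positivity, ?_⟩,
    fun A => ?_⟩
  · have : (i : ℝ) / d < 1 := by
      rw [div_lt_one hd]
      exact_mod_cast Finset.mem_range.1 hi
    calc τ * (i / d) < τ * 1 := by gcongr
      _ = τ := mul_one τ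
  · obtain ⟨p, hp, hpe⟩ := exists_polynomial_eval_eq_det_one_add_smul A
    have h := congrArg (Polynomial.eval 1)
      (Lagrange.eq_interpolate hs (f := p) (by simpa [d] using hp))
    rw [hpe, one_smul] at h
    rw [h, Lagrange.interpolate_apply, Polynomial.eval_finsetSum]
    exact Finset.sum_congr rfl fun i _ => by simp [hpe, mul_comm]

/-- A local diffeomorphism of the unit ball into itself which fixes the sphere is onto: the image of
the open ball is open, and it is relatively closed because it is the trace on the open ball of the
compact image of the closed ball. -/
theorem image_ball_eq_ball {φ : E → E} {φ' : E → E →L[ℝ] E}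
    (hφ : ∀ x ∈ closedBall (0 : E) 1, HasStrictFDerivAt φ (φ' x) x)
    (hdet : ∀ x ∈ ball (0 : E) 1, (φ' x).det ≠ 0)
    (hmaps : Set.MapsTo φ (ball 0 1) (ball 0 1))
    (hid : ∀ x ∈ sphere (0 : E) 1, φ x = x) :
    φ '' ball 0 1 = ball 0 1 := by
  refine Set.Subset.antisymm hmaps.image_subset ?_
  have hopen : IsOpen (φ '' ball 0 1) := by
    rw [isOpen_iff_mem_nhds]
    rintro _ ⟨x, hx, rfl⟩
    have hsurj : (φ' x).range = ⊤ := by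
      have h := LinearMap.isUnit_iff_isUnit_det (φ' x : E →ₗ[ℝ] E) |>.2
        (isUnit_iff_ne_zero.2 (hdet x hx))
      exact LinearMap.range_eq_top.2 ((Module.End.isUnit_iff _).1 h).2
    rw [← (hφ x (ball_subset_closedBall hx)).map_nhds_eq_of_surj hsurj]
    exact image_mem_map (isOpen_ball.mem_nhds hx)
  have hcl : IsClosed (φ '' closedBall 0 1) :=
    ((isCompact_closedBall (0 : E) 1).image_of_continuousOn
      fun x hx => (hφ x hx).continuousAt.continuousWithinAt).isClosed
  refine (convex_ball (0 : E) 1).isPreconnected.subset_of_closure_inter_subset hopen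
    ⟨φ 0, hmaps (by simp), Set.mem_image_of_mem φ (by simp)⟩ ?_
  rintro y ⟨hy, hyb⟩
  obtain ⟨x, hx, rfl⟩ := closure_minimal (Set.image_mono ball_subset_closedBall) hcl hy
  refine ⟨x, ?_, rfl⟩
  by_contra hxb
  have hxs : x ∈ sphere (0 : E) 1 := by
    rw [mem_sphere, mem_closedBall, mem_ball] at *
    exact le_antisymm hx (not_lt.1 hxb)
  rw [hid x hxs] at hyb
  exact hxb hyb

variable [MeasurableSpace E] [BorelSpace E]

/-- **No-retraction theorem** for `C¹` maps. With `g x = f x - x`, the map `x + t • g x` is a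
bijection of the unit ball with positive Jacobian for small `t ≥ 0`, so its Jacobian integrates to the volume
of the ball; by polynomial interpolation in `t`, so does the Jacobian of `f`. But that Jacobian
vanishes, as `f` takes values in the sphere. -/
theorem not_exists_retraction_sphere {f : E → E}
    (hf : ∀ x ∈ closedBall (0 : E) 1, ContDiffAt ℝ 1 f x)
    (hid : ∀ x ∈ sphere (0 : E) 1, f x = x) :
    ¬ ∀ x ∈ closedBall (0 : E) 1, ‖f x‖ = 1 := by
  intro hnorm
  set g : E → E := fun x => f x - x
  set g' : E → E →L[ℝ] E := fun x => fderiv ℝ f x - 1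
  have hstrict : ∀ x ∈ closedBall (0 : E) 1, HasStrictFDerivAt g (g' x) x := fun x hx =>
    ((hf x hx).hasStrictFDerivAt one_ne_zero).sub (hasStrictFDerivAt_id x)
  have hcont : ContinuousOn g' (closedBall 0 1) := fun x hx =>
    (((hf x hx).fderiv_right (m := 0) (by simp)).continuousAt.sub
      continuousAt_const).continuousWithinAt
  obtain ⟨K, hK⟩ := (isCompact_closedBall (0 : E) 1).exists_bound_of_continuousOn hcont
  have hK0 : 0 ≤ K := (norm_nonneg _).trans (hK 0 (by simp))
  have hLip : ∀ x ∈ closedBall (0 : E) 1, ∀ y ∈ closedBall (0 : E) 1,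
      ‖g y - g x‖ ≤ K * ‖y - x‖ := fun x hx y hy =>
    (convex_closedBall (0 : E) 1).norm_image_sub_le_of_norm_hasFDerivWithin_le
      (fun z hz => (hstrict z hz).hasFDerivAt.hasFDerivWithinAt) hK hx hy
  have hdetc : Continuous fun A : E →L[ℝ] E => A.det := ContinuousLinearMap.continuous_det
  obtain ⟨ε, hε, hdet⟩ : ∃ ε > 0, ∀ A : E →L[ℝ] E, ‖A‖ < ε → 0 < (1 + A).det := by
    have h1 : ∀ᶠ A : E →L[ℝ] E in 𝓝 0, 0 < (1 + A).det := by
      refine (hdetc.comp (continuous_const.add continuous_id)).continuousAt.eventually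
        (lt_mem_nhds ?_)
      simp [ContinuousLinearMap.det]
    obtain ⟨ε, hε, h⟩ := Metric.eventually_nhds_iff.1 h1
    exact ⟨ε, hε, fun A hA => h (by simpa using hA)⟩
  have hvol : ∀ t : ℝ, 0 ≤ t → t < min (min ε 1 / (K + 1)) 1 →
      ∫ x in ball (0 : E) 1, (1 + t • g' x).det = (volume (ball (0 : E) 1)).toReal := by
    intro t ht0 ht
    have ht1 : t < 1 := ht.trans_le (min_le_right _ _)
    have htK : t * (K + 1) < min ε 1 := by
      rw [← lt_div_iff₀ (by positivity)]
      exact ht.trans_le (min_le_left _ _)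
    have htKε : t * K < ε := by nlinarith [min_le_left ε 1]
    have htK1 : t * K < 1 := by nlinarith [min_le_right ε 1]
    have hpos : ∀ x ∈ closedBall (0 : E) 1, 0 < (1 + t • g' x).det := fun x hx => by
      refine hdet _ (lt_of_le_of_lt ?_ htKε)
      rw [norm_smul, Real.norm_of_nonneg ht0]
      exact mul_le_mul_of_nonneg_left (hK x hx) ht0
    have hφ : ∀ x ∈ closedBall (0 : E) 1,
        HasStrictFDerivAt (fun x => x + t • g x) (1 + t • g' x) x := fun x hx =>
      (hasStrictFDerivAt_id x).add ((hstrict x hx).const_smul t)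
    have hinj : Set.InjOn (fun x => x + t • g x) (ball 0 1) := by
      intro x hx y hy hxy
      have h1 : y - x = -(t • (g y - g x)) := by
        have : x + t • g x = y + t • g y := hxy
        rw [smul_sub, neg_sub, sub_eq_sub_iff_add_eq_add, ← this, add_comm]
      have h2 : ‖y - x‖ ≤ t * (K * ‖y - x‖) := by
        calc ‖y - x‖ = t * ‖g y - g x‖ := by
              rw [h1, norm_neg, norm_smul, Real.norm_of_nonneg ht0]
          _ ≤ _ := mul_le_mul_of_nonneg_left
            (hLip x (ball_subset_closedBall hx) y (ball_subset_closedBall hy)) ht0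
      have h3 : ‖y - x‖ = 0 := by nlinarith [norm_nonneg (y - x)]
      exact (sub_eq_zero.1 (norm_eq_zero.1 h3)).symm
    have himage : (fun x => x + t • g x) '' ball 0 1 = ball 0 1 := by
      refine image_ball_eq_ball hφ (fun x hx => (hpos x (ball_subset_closedBall hx)).ne') ?_ ?_
      · intro x hx
        have hx' : ‖x‖ < 1 := by simpa using hx
        have h1 : x + t • g x = (1 - t) • x + t • f x := by simp only [g]; module
        have h2 : ‖x + t • g x‖ < 1 := by
          calc ‖x + t • g x‖ ≤ ‖(1 - t) • x‖ + ‖t • f x‖ := by rw [h1]; exact norm_add_le _ _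
            _ = (1 - t) * ‖x‖ + t := by
              rw [norm_smul, norm_smul, hnorm x (ball_subset_closedBall hx), Real.norm_of_nonneg ht0,
                Real.norm_of_nonneg (by linarith), mul_one]
            _ < 1 := by nlinarith
        simpa using h2
      · intro x hx
        simp [g, hid x hx]
    have hchange := integral_image_eq_integral_abs_det_fderiv_smul volume measurableSet_ball
      (fun x hx => (hφ x (ball_subset_closedBall hx)).hasFDerivAt.hasFDerivWithinAt) hinj
      (fun _ => (1 : ℝ))
    rw [himage] at hchange
    simp only [smul_eq_mul, mul_one, integral_const, MeasurableSet.univ, measureReal_restrict_apply,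
      Set.univ_inter] at hchange
    rw [← Measure.real, hchange]
    exact setIntegral_congr_fun measurableSet_ball fun x hx =>
      (abs_of_pos (hpos x (ball_subset_closedBall hx))).symm
  obtain ⟨s, c, hs, hsum⟩ := exists_forall_det_one_add_smul_eq_sum (E := E)
    (τ := min (min ε 1 / (K + 1)) 1)
    (lt_min (div_pos (lt_min hε one_pos) (by linarith)) one_pos)
  have hint : ∀ t : ℝ, IntegrableOn (fun x => (1 + t • g' x).det) (ball 0 1) := fun t =>
    ((hdetc.comp_continuousOn (continuousOn_const.add (hcont.const_smul t))).integrableOn_compact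
      (isCompact_closedBall _ _)).mono_set ball_subset_closedBall
  have hone : ∑ i ∈ Finset.range (Module.finrank ℝ E + 1), c i = 1 := by
    have h1 : (1 : E →L[ℝ] E).det = 1 := LinearMap.det_id
    have h := hsum 0
    simp only [smul_zero, add_zero, h1, mul_one] at h
    exact h.symm
  have htotal : ∫ x in ball (0 : E) 1, (1 + g' x).det = (volume (ball (0 : E) 1)).toReal := by
    rw [setIntegral_congr_fun measurableSet_ball fun x _ => hsum (g' x)]
    rw [integral_finsetSum _ fun i _ => (hint (s i)).const_mul (c i)]
    calc _ = ∑ i ∈ Finset.range (Module.finrank ℝ E + 1),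
          c i * (volume (ball (0 : E) 1)).toReal := Finset.sum_congr rfl fun i hi => by
            rw [integral_const_mul, hvol _ (hs i hi).1 (hs i hi).2]
      _ = _ := by rw [← Finset.sum_mul, hone, one_mul]
  -- Differentiating `⟪f x, f x⟫ = 1` shows that `f x ≠ 0` is orthogonal to the range of `Df x`.
  have hzero : ∀ x ∈ ball (0 : E) 1, (1 + g' x).det = 0 := by
    intro x hx
    have hxc := ball_subset_closedBall hx
    by_contra hne
    have hfx : HasFDerivAt f (1 + g' x) x := by
      simpa [g'] using ((hf x hxc).differentiableAt one_ne_zero).hasFDerivAt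
    have hconst : HasFDerivAt (fun y => inner ℝ (f y) (f y)) (0 : E →L[ℝ] ℝ) x := by
      refine (hasFDerivAt_const (1 : ℝ) x).congr_of_eventuallyEq ?_
      filter_upwards [isOpen_ball.mem_nhds hx] with y hy
      simp [hnorm y (ball_subset_closedBall hy)]
    obtain ⟨w, hw⟩ : ∃ w, (1 + g' x) w = f x := by
      have h := LinearMap.isUnit_iff_isUnit_det ((1 + g' x : E →L[ℝ] E) : E →ₗ[ℝ] E) |>.2
        (isUnit_iff_ne_zero.2 hne)
      exact ((Module.End.isUnit_iff _).1 h).2 (f x)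
    have h := congrArg (fun L : E →L[ℝ] ℝ => L w) (hconst.unique (hfx.inner ℝ hfx))
    have h2 : (0 : ℝ) = 1 + 1 := by
      simpa only [_root_.zero_apply, ContinuousLinearMap.comp_apply,
        ContinuousLinearMap.prod_apply, fderivInnerCLM_apply, hw, real_inner_self_eq_norm_sq,
        hnorm x hxc, one_pow] using h
    norm_num at h2
  rw [setIntegral_congr_fun measurableSet_ball hzero] at htotal
  have hvpos : 0 < (volume (ball (0 : E) 1)).toReal :=
    ENNReal.toReal_pos (measure_ball_pos volume _ one_pos).ne' measure_ball_lt_top.ne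
  simp at htotal
  linarith

end Retraction
/-! ### Zeros of vector fields which nowhere point radially inward on a sphere -/

section OutwardField
open Metric

variable {E : Type*} [NormedAddCommGroup E] [InnerProductSpace ℝ E] [FiniteDimensional ℝ E]

/-- If `h` had no zero, then moving `x` in the direction `x + h x / ‖h x‖` until the sphere is met
would be a `C¹` retraction of the ball onto the sphere. -/
theorem exists_zero_of_contDiff {h : E → E} (hh : ContDiff ℝ 1 h)
    (hout : ∀ x ∈ sphere (0 : E) 1, ∀ μ : ℝ, 0 ≤ μ → h x + μ • x ≠ 0) :
    ∃ x ∈ closedBall (0 : E) 1, h x = 0 := by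
  by_contra! hne
  borelize E
  set N : E → E := fun x => ‖h x‖⁻¹ • h x
  set v : E → E := fun x => x + N x
  set a : E → ℝ := fun x => ‖v x‖ ^ 2
  set b : E → ℝ := fun x => inner ℝ x (v x)
  -- the larger solution `s` of `‖x + s • v x‖ ^ 2 = 1`
  set s : E → ℝ := fun x => (-b x + √(b x ^ 2 + a x * (1 - ‖x‖ ^ 2))) / a x
  have hN1 : ∀ x ∈ closedBall (0 : E) 1, ‖N x‖ = 1 := fun x hx =>
    norm_smul_inv_norm (𝕜 := ℝ) (hne x hx)
  have hv : ∀ x ∈ closedBall (0 : E) 1, v x ≠ 0 := by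
    intro x hx h0
    have hxN : x = -N x := eq_neg_of_add_eq_zero_left h0
    have hx1 : x ∈ sphere (0 : E) 1 := by
      rw [mem_sphere_zero_iff_norm, hxN, norm_neg, hN1 x hx]
    refine hout x hx1 ‖h x‖ (norm_nonneg _) ?_
    have h1 : ‖h x‖ • N x = h x := smul_inv_smul₀ (norm_ne_zero_iff.2 (hne x hx)) _
    calc h x + ‖h x‖ • x = ‖h x‖ • (x + N x) := by rw [smul_add, h1, add_comm]
      _ = 0 := by rw [show x + N x = 0 from h0, smul_zero]
  have ha : ∀ x ∈ closedBall (0 : E) 1, 0 < a x := fun x hx => by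
    have := norm_pos_iff.2 (hv x hx)
    positivity
  have hb : ∀ x ∈ sphere (0 : E) 1, 0 < b x := by
    intro x hx
    have h1 : a x = 2 * b x := by
      have hx1 : ‖x‖ = 1 := by simpa using hx
      simp only [a, b, v, norm_add_sq_real, inner_add_right, real_inner_self_eq_norm_sq, hx1,
        hN1 x (sphere_subset_closedBall hx)]
      ring
    linarith [ha x (sphere_subset_closedBall hx)]
  have hdisc : ∀ x ∈ closedBall (0 : E) 1, 0 < b x ^ 2 + a x * (1 - ‖x‖ ^ 2) := by
    intro x hx
    have hx1 : ‖x‖ ≤ 1 := by simpa using hx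
    rcases hx1.lt_or_eq with hlt | heq
    · have h1 : 0 < 1 - ‖x‖ ^ 2 := by nlinarith [norm_nonneg x]
      have := mul_pos (ha x hx) h1
      positivity
    · have := hb x (by simpa using heq)
      rw [heq]
      simpa using by positivity
  refine not_exists_retraction_sphere (f := fun x => x + s x • v x) ?_ ?_ ?_
  · intro x hx
    have hhx : ContDiffAt ℝ 1 h x := hh.contDiffAt
    have hNx : ContDiffAt ℝ 1 N x :=
      ((hhx.norm ℝ (hne x hx)).inv (norm_ne_zero_iff.2 (hne x hx))).smul hhx
    have hvx : ContDiffAt ℝ 1 v x := contDiffAt_id.add hNx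
    have hax : ContDiffAt ℝ 1 a x := hvx.norm_sq ℝ
    have hbx : ContDiffAt ℝ 1 b x := contDiffAt_id.inner ℝ hvx
    have hdx : ContDiffAt ℝ 1 (fun x => b x ^ 2 + a x * (1 - ‖x‖ ^ 2)) x :=
      (hbx.pow 2).add (hax.mul (contDiffAt_const.sub (contDiffAt_id.norm_sq ℝ)))
    exact contDiffAt_id.add
      (((hbx.neg.add (hdx.sqrt (hdisc x hx).ne')).div hax (ha x hx).ne').smul hvx)
  · intro x hx
    have hx1 : ‖x‖ = 1 := by simpa using hx
    simp [s, hx1, Real.sqrt_sq (hb x hx).le]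
  · intro x hx
    have hsq := Real.sq_sqrt (hdisc x hx).le
    have hsa : s x * a x = -b x + √(b x ^ 2 + a x * (1 - ‖x‖ ^ 2)) :=
      div_mul_cancel₀ _ (ha x hx).ne'
    have hquad : a x * (‖x‖ ^ 2 + 2 * (s x * b x) + s x ^ 2 * a x) = a x * 1 := by
      have : √(b x ^ 2 + a x * (1 - ‖x‖ ^ 2)) = s x * a x + b x := by linarith
      rw [this] at hsq
      linarith
    have hnorm : ‖x + s x • v x‖ ^ 2 = 1 := by
      rw [norm_add_sq_real, inner_smul_right, norm_smul, mul_pow, Real.norm_eq_abs, sq_abs]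
      exact mul_left_cancel₀ (ha x hx).ne' hquad
    nlinarith [norm_nonneg (x + s x • v x)]

/-- Continuous version of `exists_zero_of_contDiff`, by smooth approximation. -/
theorem exists_zero_of_continuous {h : E → E} (hh : Continuous h) {c : ℝ} (hc : 0 < c)
    (hout : ∀ x ∈ sphere (0 : E) 1, ∀ μ : ℝ, 0 ≤ μ → c ≤ ‖h x + μ • x‖) :
    ∃ x ∈ closedBall (0 : E) 1, h x = 0 := by
  by_contra! hne
  obtain ⟨m, hm, hmle⟩ := (isCompact_closedBall (0 : E) 1).exists_forall_le'
    hh.norm.continuousOn fun x hx => norm_pos_iff.2 (hne x hx)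
  obtain ⟨g, hg, hgh, -⟩ := hh.exists_contDiff_approx 1 (ε := fun _ => min c m)
    continuous_const fun _ => lt_min hc hm
  have hclose : ∀ x, ‖g x - h x‖ < min c m := fun x => by simpa [dist_eq_norm] using hgh x
  obtain ⟨x, hx, hgx⟩ := exists_zero_of_contDiff (h := g) (by exact_mod_cast hg) (by
    intro x hx μ hμ h0
    have h1 : h x + μ • x = -(g x - h x) := by
      rw [neg_sub, eq_sub_iff_add_eq, add_right_comm, add_assoc, h0, add_zero]
    have h2 := hout x hx μ hμ
    rw [h1, norm_neg] at h2
    exact absurd h2 (not_le.2 ((hclose x).trans_le (min_le_left _ _))))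
  have h1 := hclose x
  rw [hgx, zero_sub, norm_neg] at h1
  exact absurd (hmle x hx) (not_le.2 (h1.trans_le (min_le_right _ _)))

/-- If a vector field `f` nowhere on a sphere vanishes or points radially inward, then all continuous
vector fields uniformly close to `f` have a zero in the ball. -/
theorem exists_forall_exists_zero_of_near {f : E → E} (hf : Continuous f) {x₀ : E} {r : ℝ}
    (hr : 0 < r)
    (hout : ∀ x ∈ sphere x₀ r, ∀ μ : ℝ, 0 ≤ μ → f x + μ • (x - x₀) ≠ 0) :
    ∃ c > 0, ∀ h : E → E, Continuous h → (∀ x ∈ closedBall x₀ r, ‖h x - f x‖ < c) →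
      ∃ x ∈ closedBall x₀ r, h x = 0 := by
  obtain ⟨M, hM⟩ := (isCompact_sphere x₀ r).exists_bound_of_continuousOn hf.continuousOn
  -- For `μ ≥ (M + 1) / r` the summand `μ • (x - x₀)` dominates `f x`.
  obtain ⟨c, hc, hcle⟩ := ((isCompact_sphere x₀ r).prod
    (isCompact_Icc (a := (0 : ℝ)) (b := (M + 1) / r))).exists_forall_le'
    (f := fun p => ‖f p.1 + p.2 • (p.1 - x₀)‖) (by fun_prop)
    (a := 0) (fun p hp => norm_pos_iff.2 (hout p.1 hp.1 p.2 hp.2.1))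
  have hlower : ∀ x ∈ sphere x₀ r, ∀ μ : ℝ, 0 ≤ μ → min c 1 ≤ ‖f x + μ • (x - x₀)‖ := by
    intro x hx μ hμ
    rcases le_total μ ((M + 1) / r) with hle | hge
    · exact (min_le_left _ _).trans (hcle (x, μ) ⟨hx, hμ, hle⟩)
    · refine (min_le_right _ _).trans ?_
      have h1 : ‖μ • (x - x₀)‖ = μ * r := by
        rw [norm_smul, Real.norm_of_nonneg hμ, mem_sphere_iff_norm.1 hx]
      have h2 : ‖μ • (x - x₀)‖ - ‖f x‖ ≤ ‖f x + μ • (x - x₀)‖ := by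
        rw [add_comm]
        simpa using norm_sub_norm_le (μ • (x - x₀)) (-f x)
      have h3 : M + 1 ≤ μ * r := (div_le_iff₀ hr).1 hge
      linarith [hM x hx]
  have hc1 : 0 < min c 1 := lt_min hc one_pos
  refine ⟨min c 1 / 2, half_pos hc1, fun h hh hclose => ?_⟩
  have hmem : ∀ z : E, ∀ ρ, ‖z‖ = ρ → ‖x₀ + r • z - x₀‖ = r * ρ := fun z ρ hz => by
    rw [add_sub_cancel_left, norm_smul, Real.norm_of_nonneg hr.le, hz]
  obtain ⟨z, hz, hhz⟩ := exists_zero_of_continuous (h := fun z => h (x₀ + r • z)) (by fun_prop)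
    (half_pos hc1) (by
      intro z hz μ hμ
      have hx : x₀ + r • z ∈ sphere x₀ r := by
        rw [mem_sphere_iff_norm, hmem z 1 (by simpa using hz), mul_one]
      have h1 := hlower _ hx (μ / r) (by positivity)
      rw [add_sub_cancel_left, smul_smul, div_mul_cancel₀ _ hr.ne'] at h1
      have h2 := hclose _ (sphere_subset_closedBall hx)
      have h3 : ‖f (x₀ + r • z) + μ • z‖ ≤
          ‖h (x₀ + r • z) + μ • z‖ + ‖h (x₀ + r • z) - f (x₀ + r • z)‖ := by
        refine le_trans (le_of_eq (congrArg norm ?_)) (norm_sub_le _ _)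
        abel
      linarith)
  refine ⟨x₀ + r • z, ?_, hhz⟩
  rw [mem_closedBall_iff_norm, hmem z _ rfl]
  have hz1 : ‖z‖ ≤ 1 := by simpa using hz
  nlinarith

end OutwardField
/-! ### Orthogonal projections as functions on the oriented Grassmannian -/

section Grassmannian

variable {k n : ℕ}

theorem starProjection_span_range_apply {E ι : Type*} [NormedAddCommGroup E]
    [InnerProductSpace ℝ E] [FiniteDimensional ℝ E] [Fintype ι] [DecidableEq ι] {b : ι → E}
    (hb : LinearIndependent ℝ b) (z : E) :
    (Submodule.span ℝ (Set.range b)).starProjection z =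
      ∑ i, ((Matrix.gram ℝ b)⁻¹.mulVec fun j => inner ℝ (b j) z) i • b i := by
  set c := (Matrix.gram ℝ b)⁻¹.mulVec fun j => inner ℝ (b j) z with hc
  have hG : (Matrix.gram ℝ b).mulVec c = fun j => inner ℝ (b j) z := by
    rw [hc, Matrix.mulVec_mulVec, Matrix.mul_nonsing_inv _
      (isUnit_iff_ne_zero.2 (Matrix.det_gram_ne_zero_iff_linearIndependent.2 hb)),
      Matrix.one_mulVec]
  refine Submodule.eq_starProjection_of_mem_of_inner_eq_zero
    (Submodule.sum_mem _ fun i _ => Submodule.smul_mem _ _ (Submodule.subset_span ⟨i, rfl⟩)) ?_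
  intro w hw
  induction hw using Submodule.span_induction with
  | mem x hx =>
    obtain ⟨j, rfl⟩ := hx
    have hj := congrFun hG j
    simp only [Matrix.mulVec, dotProduct, Matrix.gram_apply] at hj
    rw [inner_sub_left, sum_inner, real_inner_comm, ← hj, sub_eq_zero]
    exact Finset.sum_congr rfl fun i _ => by
      rw [inner_smul_left, real_inner_comm, mul_comm]; rfl
  | zero => exact inner_zero_right _
  | add x y _ _ hx hy => rw [inner_add_right, hx, hy, add_zero]
  | smul a x _ hx => rw [inner_smul_right, hx, mul_zero]

/-- The orthogonal projection onto an oriented plane depends continuously on the plane, in the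
quotient topology of `G_k(n)`. -/
theorem continuous_starProjection_plane :
    Continuous fun w : OrientedGrassmannian k n => w.plane.starProjection := by
  refine continuous_coinduced_dom.2 (continuous_clm_apply.2 fun z => ?_)
  have hcoe : ∀ i, Continuous fun b : Frame k n => b.1 i := fun i =>
    (continuous_apply i).comp continuous_subtype_val
  have hgram : Continuous fun b : Frame k n => Matrix.gram ℝ b.1 :=
    continuous_matrix fun i j => (hcoe i).inner (hcoe j)
  have hinv : Continuous fun b : Frame k n => (Matrix.gram ℝ b.1)⁻¹ := by
    simp_rw [Matrix.inv_def, Ring.inverse_eq_inv']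
    exact (hgram.matrix_det.inv₀ fun b =>
      Matrix.det_gram_ne_zero_iff_linearIndependent.2 b.2).smul hgram.matrix_adjugate
  have hvec : Continuous fun b : Frame k n =>
      (Matrix.gram ℝ b.1)⁻¹.mulVec fun j => inner ℝ (b.1 j) z :=
    hinv.matrix_mulVec (continuous_pi fun j => (hcoe j).inner continuous_const)
  refine (continuous_finsetSum Finset.univ fun i _ =>
    ((continuous_apply i).comp hvec).smul (hcoe i)).congr fun b => ?_
  exact (starProjection_span_range_apply b.2 z).symm

end Grassmannian

/-! ### Skew fibrations near infinity -/

section Fibration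

variable {k n : ℕ} {F : EuclideanSpace ℝ (Fin n) → AffineOrientedGrassmannian k n}

theorem IsFibration.continuous_dirMap (hF : IsFibration F) : Continuous (dirMap F) :=
  (continuous_fst.comp continuous_induced_dom).comp hF.continuous

theorem IsFibration.mem_iff_sub_mem (hF : IsFibration F) {x y : EuclideanSpace ℝ (Fin n)} :
    y ∈ (F x).toAffineSubspace ↔ y - x ∈ (dirMap F x).plane := by
  have hx : x - (F x).point ∈ (F x).direction.plane := AffineSubspace.mem_mk'.1 (hF.mem_fiber x)
  refine AffineSubspace.mem_mk'.trans ?_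
  rw [vsub_eq_sub, ← sub_add_sub_cancel y x (F x).point]
  exact Submodule.add_mem_iff_left _ hx

theorem IsFibration.eq_of_sub_mem (hF : IsFibration F) {x y : EuclideanSpace ℝ (Fin n)}
    (h : y - x ∈ (dirMap F x).plane) : F y = F x :=
  hF.fiber_eq x y (hF.mem_iff_sub_mem.2 h)

theorem IsSkewFibration.eq_of_mem_of_mem (hF : IsSkewFibration F) {x y w : EuclideanSpace ℝ (Fin n)}
    (hw : w ≠ 0) (hx : w ∈ (dirMap F x).plane) (hy : w ∈ (dirMap F y).plane) : F x = F y := by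
  by_contra hne
  have hle : ∀ z, w ∈ (dirMap F z).plane →
      AffineSubspace.mk' z (Submodule.span ℝ {w}) ≤ (F z).toAffineSubspace := by
    intro z hz p hp
    refine hF.mem_iff_sub_mem.2 ?_
    exact (Submodule.span_singleton_le_iff_mem _ _).2 hz (AffineSubspace.mem_mk'.1 hp)
  refine hF.skew x y hne (AffineSubspace.mk' x (Submodule.span ℝ {w}))
    (AffineSubspace.mk' y (Submodule.span ℝ {w})) ?_ ?_ (hle x hx) (hle y hy) ?_
  · rw [AffineSubspace.direction_mk', finrank_span_singleton hw]
  · rw [AffineSubspace.direction_mk', finrank_span_singleton hw]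
  · rw [AffineSubspace.parallel_iff_direction_eq_and_eq_bot_iff_eq_bot]
    refine ⟨by simp only [AffineSubspace.direction_mk'], iff_of_false ?_ ?_⟩
    · exact (AffineSubspace.nonempty_iff_ne_bot _).1 (AffineSubspace.mk'_nonempty _ _)
    · exact (AffineSubspace.nonempty_iff_ne_bot _).1 (AffineSubspace.mk'_nonempty _ _)

/-- Continuity at infinity: the direction of the fiber through `y` is close to `u` when `y` is far
from the origin and `y / ‖y‖` is close to a nonzero vector `ℓ` in `u`. -/
theorem IsSkewFibration.exists_dirMap_mem (hF : IsSkewFibration F)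
    {u : OrientedGrassmannian k n} (hu : u ∈ baseSpace F)
    {ℓ : EuclideanSpace ℝ (Fin n)} (hℓ : ℓ ≠ 0) (hℓu : ℓ ∈ u.plane)
    {D : Set (OrientedGrassmannian k n)} (hD : D ∈ 𝓝 u) :
    ∃ N : ℝ, ∃ ε > 0, ∀ y : EuclideanSpace ℝ (Fin n), N ≤ ‖y‖ → ‖‖y‖⁻¹ • y - ℓ‖ < ε →
      dirMap F y ∈ D := by
  obtain ⟨x₁, rfl⟩ := hu
  set P := (dirMap F x₁).plane.starProjection with hP
  have hPmem : ∀ z, P z ∈ (dirMap F x₁).plane := fun z =>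
    Submodule.starProjection_apply_mem _ z
  have hPself : ∀ z ∈ (dirMap F x₁).plane, P z = z := fun z hz =>
    Submodule.starProjection_eq_self_iff.2 hz
  have hPP : ∀ z, P (P z) = P z := fun z => hPself _ (hPmem z)
  -- the point of the given fiber nearest to the origin
  set v := x₁ - P x₁ with hv
  have hPv : P v = 0 := by rw [hv, map_sub, hPP, sub_self]
  have hFv : F v = F x₁ := hF.eq_of_sub_mem (by
    rw [hv, sub_sub_cancel_left]; exact neg_mem (hPmem x₁))
  have hdirv : dirMap F v = dirMap F x₁ := congrArg AffineOrientedGrassmannian.direction hFv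
  set Q : EuclideanSpace ℝ (Fin n) → EuclideanSpace ℝ (Fin n) →L[ℝ] EuclideanSpace ℝ (Fin n) :=
    fun t => (dirMap F t).plane.starProjection with hQ
  have hQmem : ∀ t z, Q t z ∈ (dirMap F t).plane := fun t z =>
    Submodule.starProjection_apply_mem _ z
  have hQc : Continuous Q := continuous_starProjection_plane.comp hF.continuous_dirMap
  set Φ : EuclideanSpace ℝ (Fin n) → EuclideanSpace ℝ (Fin n) := fun x => Q (x - P x) (P x) with hΦ
  have hΦc : Continuous Φ :=
    (hQc.comp (continuous_id.sub P.continuous)).clm_apply P.continuous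
  have hΦmem : ∀ x, Φ x ∈ (dirMap F (x - P x)).plane := fun x => hQmem _ _
  -- The fiber through `v` meets `uᗮ` only in `v`.
  have huniq : ∀ x, F (x - P x) = F v → x - P x = v := by
    intro x hx
    have h1 : x - P x - v ∈ (dirMap F x₁).plane := by
      rw [← hdirv, ← hF.mem_iff_sub_mem, ← hx]
      exact hF.mem_fiber _
    have h2 : P (x - P x - v) = 0 := by rw [map_sub, map_sub, hPP, hPv, sub_self, sub_zero]
    rw [hPself _ h1] at h2
    exact sub_eq_zero.1 h2
  obtain ⟨r, hr, hrD⟩ : ∃ r > 0, ∀ t ∈ Metric.closedBall v r, dirMap F t ∈ D := by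
    have h1 : dirMap F ⁻¹' D ∈ 𝓝 v :=
      hF.continuous_dirMap.continuousAt.preimage_mem_nhds (hdirv.symm ▸ hD)
    exact Metric.nhds_basis_closedBall.mem_iff.1 h1
  have hPℓ : P ℓ = ℓ := hPself ℓ hℓu
  have hout : ∀ x ∈ Metric.sphere (v + ℓ) r, ∀ μ : ℝ, 0 ≤ μ →
      (Φ x - ℓ) + μ • (x - (v + ℓ)) ≠ 0 := by
    intro x hx μ hμ h0
    have hPh0 : P (Φ x) - ℓ + μ • (P x - ℓ) = 0 := by
      have h1 := congrArg P h0
      simpa [hPv, hPℓ] using h1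
    have ht : x - P x = v := by
      apply huniq
      rcases hμ.eq_or_lt with rfl | hμ
      · -- `Φ x = ℓ` is a direction common to the fibers through `x - P x` and `v`.
        have h1 : Φ x = ℓ := by simpa [sub_eq_zero] using h0
        exact hF.eq_of_mem_of_mem hℓ (h1 ▸ hΦmem x) (hdirv ▸ hℓu)
      · -- The point `x - P x + μ⁻¹ • Φ x` lies on the fibers through `x - P x` and `v`.
        have h1 : μ • (x - P x) + Φ x = μ • v + P (Φ x) := by
          have h2 := h0.trans hPh0.symm
          rw [← sub_eq_zero] at h2 ⊢
          rw [← h2]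
          module
        have h3 : x - P x + μ⁻¹ • Φ x = v + μ⁻¹ • P (Φ x) := by
          have h4 := congrArg (μ⁻¹ • ·) h1
          simpa [smul_add, smul_smul, inv_mul_cancel₀ hμ.ne'] using h4
        have h5 : F (x - P x + μ⁻¹ • Φ x) = F (x - P x) := hF.eq_of_sub_mem (by
          rw [add_sub_cancel_left]; exact Submodule.smul_mem _ _ (hΦmem x))
        have h6 : F (v + μ⁻¹ • P (Φ x)) = F v := hF.eq_of_sub_mem (by
          rw [add_sub_cancel_left, hdirv]; exact Submodule.smul_mem _ _ (hPmem _))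
        rw [← h5, h3, h6]
    -- Over `v` the projection `Q` is `P`, so the equation becomes `(1 + μ) • (P x - ℓ) = 0`.
    have hΦx : P (Φ x) = P x := by
      have : Φ x = P x := by
        simp only [hΦ, ht, hQ, hdirv]
        exact hPP x
      rw [this, hPP]
    rw [hΦx, show P x - ℓ + μ • (P x - ℓ) = (1 + μ) • (P x - ℓ) by module, smul_eq_zero] at hPh0
    have h7 : P x = ℓ := sub_eq_zero.1 (hPh0.resolve_left (by positivity))
    have h8 : x = v + ℓ := by rw [← ht, h7, sub_add_cancel]
    rw [h8, Metric.mem_sphere, dist_self] at hx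
    exact hr.ne hx
  obtain ⟨c, hc, hnear⟩ := exists_forall_exists_zero_of_near (hΦc.sub continuous_const) hr hout
  obtain ⟨M, hM⟩ := (isCompact_closedBall (v + ℓ) r).exists_bound_of_continuousOn
    (f := fun x => x - P x) (by fun_prop)
  have hM0 : 0 ≤ M := (norm_nonneg _).trans (hM (v + ℓ) (by simp [hr.le]))
  refine ⟨2 * (M + 1) / c, c / 2, by positivity, fun y hyN hyε => ?_⟩
  have hy : 0 < ‖y‖ := lt_of_lt_of_le (by positivity) hyN
  obtain ⟨x, hx, hhx⟩ := hnear
    (fun x => ‖y‖⁻¹ • (x - P x) + Φ x - ‖y‖⁻¹ • y) (by fun_prop) (by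
      intro x hx
      have h1 : ‖y‖⁻¹ • (x - P x) + Φ x - ‖y‖⁻¹ • y - (Φ x - ℓ) =
          ‖y‖⁻¹ • (x - P x) - (‖y‖⁻¹ • y - ℓ) := by abel
      have h2 : ‖‖y‖⁻¹ • (x - P x)‖ < c / 2 := by
        rw [norm_smul, norm_inv, norm_norm, inv_mul_lt_iff₀ hy]
        have h3 : 2 * (M + 1) ≤ ‖y‖ * c := (div_le_iff₀ hc).1 hyN
        linarith [hM x hx]
      change ‖‖y‖⁻¹ • (x - P x) + Φ x - ‖y‖⁻¹ • y - (Φ x - ℓ)‖ < c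
      rw [h1]
      linarith [norm_sub_le (‖y‖⁻¹ • (x - P x)) (‖y‖⁻¹ • y - ℓ)])
  have hyx : y = x - P x + ‖y‖ • Φ x := by
    have h1 := congrArg (‖y‖ • ·) hhx
    simp only [smul_sub, smul_add, smul_smul, mul_inv_cancel₀ hy.ne', one_smul, smul_zero] at h1
    rw [eq_comm, ← sub_eq_zero]
    simpa using h1
  have hFy : F y = F (x - P x) := hF.eq_of_sub_mem (by
    rw [sub_eq_iff_eq_add'.2 hyx]
    exact Submodule.smul_mem _ _ (hΦmem x))
  have hdir : dirMap F y = dirMap F (x - P x) :=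
    congrArg AffineOrientedGrassmannian.direction hFy
  rw [hdir]
  refine hrD _ ?_
  rw [mem_closedBall_iff_norm] at hx ⊢
  -- `x - P x - v` is the component of `x - (v + ℓ)` orthogonal to the plane `u`.
  have h1 : x - P x - v = (dirMap F x₁).planeᗮ.starProjection (x - (v + ℓ)) := by
    rw [Submodule.starProjection_orthogonal_val, ← hP, map_sub, map_add, hPv, hPℓ]
    abel
  rw [h1]
  exact (Submodule.norm_starProjection_apply_le _ _).trans hx

end Fibration
end SkewFib

theorem mainTheorem2 (k n : ℕ)
    (F : EuclideanSpace ℝ (Fin n) → SkewFib.AffineOrientedGrassmannian k n)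
    (hF : SkewFib.IsSkewFibration F)
    (u : SkewFib.OrientedGrassmannian k n) (hu : u ∈ SkewFib.baseSpace F)
    (ℓ : EuclideanSpace ℝ (Fin n)) (hℓ : ‖ℓ‖ = 1) (hℓu : ℓ ∈ u.plane) :
    (∀ y : ℕ → EuclideanSpace ℝ (Fin n),
      Tendsto (fun m => ‖y m‖) atTop atTop →
      Tendsto (fun m => ‖y m‖⁻¹ • y m) atTop (𝓝 ℓ) →
      Tendsto (fun m => SkewFib.dirMap F (y m)) atTop (𝓝 u)) ∧
    (∀ D ∈ 𝓝[SkewFib.baseSpace F] u, ∃ N δ : ℝ, 1 ≤ N ∧ 0 < δ ∧ δ < Real.pi / 2 ∧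
      SkewFib.cone ℓ N δ ⊆ SkewFib.dirMap F ⁻¹' D) := by
  have hℓ0 : ℓ ≠ 0 := norm_ne_zero_iff.1 (hℓ ▸ one_ne_zero)
  constructor
  · intro y hy hyℓ
    refine tendsto_def.2 fun D hD => ?_
    obtain ⟨N, ε, hε, h⟩ := hF.exists_dirMap_mem hu hℓ0 hℓu hD
    filter_upwards [hy.eventually_ge_atTop N, Metric.tendsto_nhds.1 hyℓ ε hε] with m hmN hmε
    exact h (y m) hmN (by rwa [dist_eq_norm] at hmε)
  · intro D hD
    obtain ⟨D', hD', hsub⟩ := mem_nhdsWithin_iff_exists_mem_nhds_inter.1 hD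
    obtain ⟨N, ε, hε, h⟩ := hF.exists_dirMap_mem hu hℓ0 hℓu hD'
    -- For a unit vector `z` at angle `θ` with `ℓ`, `‖z - ℓ‖ ^ 2 = 2 - 2 * cos θ`.
    obtain ⟨δ, hδ, hcos⟩ : ∃ δ > 0, ∀ θ : ℝ, |θ| < δ → 1 - ε ^ 2 / 2 < Real.cos θ := by
      have h1 : ∀ᶠ θ : ℝ in 𝓝 0, 1 - ε ^ 2 / 2 < Real.cos θ :=
        Real.continuous_cos.continuousAt.eventually (lt_mem_nhds (by
          rw [Real.cos_zero]; linarith [pow_pos hε 2]))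
      obtain ⟨δ, hδ, h2⟩ := Metric.eventually_nhds_iff.1 h1
      exact ⟨δ, hδ, fun θ hθ => h2 (by simpa using hθ)⟩
    refine ⟨max N 1, min (δ / 2) (Real.pi / 4), le_max_right _ _,
      lt_min (by positivity) (by positivity),
      (min_le_right _ _).trans_lt (by linarith [Real.pi_pos]), ?_⟩
    rintro y ⟨hyN, hyδ⟩
    have hnorm : max N 1 ≤ ‖y‖ :=
      hyN.trans ((real_inner_le_norm y ℓ).trans (by rw [hℓ, mul_one]))
    have hy0 : 0 < ‖y‖ := lt_of_lt_of_le one_pos ((le_max_right _ _).trans hnorm)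
    refine hsub ⟨h y ((le_max_left _ _).trans hnorm) ?_, ⟨y, rfl⟩⟩
    have hangle : 1 - ε ^ 2 / 2 < Real.cos (InnerProductGeometry.angle y ℓ) := by
      refine hcos _ ?_
      rw [abs_of_nonneg (InnerProductGeometry.angle_nonneg y ℓ)]
      linarith [min_le_left (δ / 2) (Real.pi / 4)]
    have hsq : ‖‖y‖⁻¹ • y - ℓ‖ ^ 2 < ε ^ 2 := by
      have h1 : ‖‖y‖⁻¹ • y‖ = 1 := norm_smul_inv_norm (𝕜 := ℝ) (norm_pos_iff.1 hy0)
      have h2 : inner ℝ (‖y‖⁻¹ • y) ℓ = Real.cos (InnerProductGeometry.angle y ℓ) := by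
        rw [InnerProductGeometry.cos_angle, real_inner_smul_left, hℓ, mul_one, inv_mul_eq_div]
      rw [norm_sub_sq_real, h1, h2, hℓ]
      linarith
    exact lt_of_pow_lt_pow_left₀ 2 hε.le hsq
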